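/- Let $\sigma_0>0$, $N>0$, $P\ge 0$, and let $n\ge 1$ be an integer. Let $A\sim\mathcal N(0,\sigma_0^2)$ and let $Z_1,\dots,Z_n\sim\mathcal N(0,N)$ be mutually independent and independent of $A$. For arbitrary (measurable) encoding functions $f_i$ and decoding functions $g_i$, consider $n$ uses of the additive white Gaussian noise channel with noiseless feedback: for $i=1,\dots,n$, $$X_i=f_i(A,\widehat A_1,\dots,\widehat A_{i-1}),\qquad Y_i=X_i+Z_i,\qquad \widehat A_i=g_i(Y_1,\dots,Y_i),$$ and suppose that the power constraint $\mathbb E[X_i^2]\le P$ holds for $i=1,\dots,n$. Let $C$ be the Shannon capacity, in bits per channel use, of the channel $Y=X+Z$, $Z\sim\mathcal N(0,N)$, under the power constraint $\mathbb E[X^2]\le P$, that is, the supremum of the mutual information $I(X;X+Z)$ over all $X$ independent of $Z$ with $\mathbb E[X^2]\le P$; let $D_n=\mathbb E[(A-\widehat A_n)^2]\in[0,\infty]$ be the quadratic distortion, and let $I(A;\widehat A_n)$ be the mutual information in bits. Then $C=\tfrac12\log_2(1+P/N)$ and $$\tfrac12\log_2\frac{\sigma_0^2}{D_n}\;\le\;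 I(A;\widehat A_n)\;\le\; nC,$$ where the left-hand side is read as $+\infty$ if $D_n=0$ and as $-\infty$ if $D_n=\infty$. -/

import Mathlib

open MeasureTheory ProbabilityTheory
open scoped NNReal ENNReal

/-- Binary logarithm of an extended nonnegative real, with `log₂ 0 = -∞` and `log₂ ∞ = +∞`. -/
noncomputable def elogb2 (x : ℝ≥0∞) : EReal :=
  ENNReal.log x / ((Real.log 2 : ℝ) : EReal)

/-- Shannon's mutual information `I(X; Y)` in bits: the Kullback-Leibler divergence (computed by
Mathlib in nats) of the joint law of `(X, Y)` from the product of the marginal laws. -/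
noncomputable def mutualInfoBits {Ω α β : Type*} [MeasurableSpace Ω] [MeasurableSpace α]
    [MeasurableSpace β] (μ : Measure Ω) (X : Ω → α) (Y : Ω → β) : ℝ≥0∞ :=
  InformationTheory.klDiv (μ.map (fun ω => (X ω, Y ω))) ((μ.map X).prod (μ.map Y))
    / ENNReal.ofReal (Real.log 2)

/-- Second moment `E[X²]`, possibly infinite. -/
noncomputable def secondMoment {Ω : Type*} [MeasurableSpace Ω] (μ : Measure Ω) (X : Ω → ℝ) :
    ℝ≥0∞ :=
  ∫⁻ ω, ENNReal.ofReal (X ω ^ 2) ∂μ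

/-- Shannon capacity (in bits per channel use) of the additive white Gaussian noise channel
`Y = X + Z`, `Z ∼ 𝓝(0, N)`, under the power constraint `E[X²] ≤ P`: the supremum of `I(X; X + Z)`
over all laws `p` of an input `X` independent of `Z` that satisfy the constraint. -/
noncomputable def awgnCapacity (P N : ℝ≥0) : ℝ≥0∞ :=
  ⨆ (p : Measure ℝ) (_ : IsProbabilityMeasure p) (_ : secondMoment p id ≤ (P : ℝ≥0∞)),
    mutualInfoBits (p.prod (gaussianReal 0 N)) (fun w => w.1) (fun w => w.1 + w.2)

/-- `n` uses of an additive white Gaussian noise channel with noise power `N`, input power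
constraint `P` and noiseless feedback, for the transmission of a source `A ∼ 𝓝(0, σ₀²)`.
Steps are numbered from `0`, so `X i`, `Y i`, `Z i`, `Ahat i` belong to the `(i + 1)`-st use.
The encoder `f i` sees the source and all the earlier outputs of the decoder; the decoder `g i`
sees all the channel outputs received so far. -/
structure IsFeedbackTransmission {Ω : Type*} [MeasurableSpace Ω] (μ : Measure Ω) (n : ℕ)
    (σ₀ P N : ℝ≥0)
    (f : (i : ℕ) → ℝ × (Fin i → ℝ) → ℝ) (g : (i : ℕ) → (Fin (i + 1) → ℝ) → ℝ)
    (A : Ω → ℝ) (X Y Z Ahat : ℕ → Ω → ℝ) : Prop where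
  measurable_encoder : ∀ i < n, Measurable (f i)
  measurable_decoder : ∀ i < n, Measurable (g i)
  measurable_source : Measurable A
  measurable_noise : ∀ i < n, Measurable (Z i)
  law_source : μ.map A = gaussianReal 0 (σ₀ ^ 2)
  law_noise : ∀ i < n, μ.map (Z i) = gaussianReal 0 N
  /-- the noise is white -/
  indep_noise : iIndepFun (fun i : Fin n => Z i) μ
  /-- the noise is independent of the source -/
  indep_source_noise : IndepFun A (fun ω (i : Fin n) => Z i ω) μ
  encode : ∀ i < n, ∀ ω, X i ω = f i (A ω, fun j : Fin i => Ahat j ω)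
  channel : ∀ i < n, ∀ ω, Y i ω = X i ω + Z i ω
  decode : ∀ i < n, ∀ ω, Ahat i ω = g i (fun j : Fin (i + 1) => Y j ω)
  power : ∀ i < n, secondMoment μ (X i) ≤ (P : ℝ≥0∞)

/-! Both inequalities are variational bounds on a Kullback-Leibler divergence with an explicit
Gaussian candidate.

Upper bound: replacing the second marginal by any law `Q` can only increase the divergence from the
product (`klDiv_prod_marginals_le`). For the channel outputs, take `Q` to be a product of laws `𝓝(0,
P + N)`. The input is a function of the source and past outputs, and the fresh noise is independent
of these, so each use applies a Gaussian kernel; by the chain rule it adds at most `log(1 + P/N)/2`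
nats, feedback or not. Data processing then passes from the outputs to the final estimate. One use
gives the converse for the capacity, and a Gaussian input attains it.

Lower bound: Gibbs' inequality is applied to the test function "log-density of `𝓝(Ahat, D)` relative
to the source law, evaluated at `A`" (`log_div_le_toReal_klDiv`). -/

/-! ### Gaussian likelihood ratios and second moments. -/

/-- The log-likelihood ratio of `𝓝(m, v)` with respect to `𝓝(0, w)`, at `y`. -/
noncomputable def gaussianLogRatio (w v : ℝ≥0) (m y : ℝ) : ℝ :=
  Real.log ((w : ℝ) / v) / 2 - (y - m) ^ 2 / (2 * v) + y ^ 2 / (2 * w)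

lemma Measurable.gaussianLogRatio {α : Type*} [MeasurableSpace α] {f g : α → ℝ}
    (hf : Measurable f) (hg : Measurable g) (w v : ℝ≥0) :
    Measurable (fun x => gaussianLogRatio w v (f x) (g x)) := by
  unfold _root_.gaussianLogRatio
  fun_prop

lemma gaussianPDFReal_mul_exp_gaussianLogRatio {w v : ℝ≥0} (hw : w ≠ 0) (hv : v ≠ 0) (m y : ℝ) :
    gaussianPDFReal 0 w y * Real.exp (gaussianLogRatio w v m y) = gaussianPDFReal m v y := by
  have hw' : (0 : ℝ) < w := by positivity
  have hv' : (0 : ℝ) < v := by positivity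
  have hsqrt : Real.exp (Real.log ((w : ℝ) / v) / 2) = √w / √v := by
    rw [← Real.sqrt_div hw'.le, Real.sqrt_eq_rpow, Real.rpow_def_of_pos (by positivity)]
    ring_nf
  have hexp : Real.exp (-(y - 0) ^ 2 / (2 * w)) *
      (Real.exp (-((y - m) ^ 2 / (2 * v))) * Real.exp (y ^ 2 / (2 * w))) =
      Real.exp (-(y - m) ^ 2 / (2 * v)) := by
    rw [← Real.exp_add, ← Real.exp_add]
    ring_nf
  rw [gaussianPDFReal, gaussianPDFReal, gaussianLogRatio, sub_eq_add_neg (_ / 2), Real.exp_add,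
    Real.exp_add, hsqrt, ← hexp, Real.sqrt_mul (by positivity), Real.sqrt_mul (by positivity) (v : ℝ)]
  have : √(w : ℝ) ≠ 0 := by positivity
  have : √(v : ℝ) ≠ 0 := by positivity
  field_simp

lemma gaussianReal_eq_withDensity_gaussianLogRatio {w v : ℝ≥0} (hw : w ≠ 0) (hv : v ≠ 0) (m : ℝ) :
    gaussianReal m v = (gaussianReal 0 w).withDensity
      (fun y => ENNReal.ofReal (Real.exp (gaussianLogRatio w v m y))) := by
  have hmeas : Measurable (fun y => ENNReal.ofReal (Real.exp (gaussianLogRatio w v m y))) := by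
    unfold gaussianLogRatio
    fun_prop
  rw [gaussianReal_of_var_ne_zero _ hw, gaussianReal_of_var_ne_zero _ hv,
    ← withDensity_mul _ (measurable_gaussianPDF 0 w) hmeas]
  congr 1
  funext y
  rw [Pi.mul_apply, gaussianPDF, gaussianPDF, ← ENNReal.ofReal_mul (gaussianPDFReal_nonneg _ _ _),
    gaussianPDFReal_mul_exp_gaussianLogRatio hw hv]

lemma lintegral_exp_gaussianLogRatio {w v : ℝ≥0} (hw : w ≠ 0) (hv : v ≠ 0) (m : ℝ) :
    ∫⁻ y, ENNReal.ofReal (Real.exp (gaussianLogRatio w v m y)) ∂(gaussianReal 0 w) = 1 := by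
  have h := congrArg (fun μ : Measure ℝ => μ Set.univ)
    (gaussianReal_eq_withDensity_gaussianLogRatio hw hv m)
  simpa using h.symm

lemma integrable_sq_of_secondMoment_ne_top {α : Type*} [MeasurableSpace α] {ν : Measure α} {m : α → ℝ}
    (hm : AEMeasurable m ν) (h : secondMoment ν m ≠ ⊤) : Integrable (fun x => m x ^ 2) ν :=
  (lintegral_ofReal_ne_top_iff_integrable (by fun_prop)
    (Filter.Eventually.of_forall fun _ => sq_nonneg _)).1 h

lemma integrable_of_integrable_sq {α : Type*} [MeasurableSpace α] {ν : Measure α}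
    [IsFiniteMeasure ν] {m : α → ℝ} (hm : AEStronglyMeasurable m ν)
    (h : Integrable (fun x => m x ^ 2) ν) : Integrable m ν :=
  ((memLp_two_iff_integrable_sq hm).2 h).integrable one_le_two

lemma integral_sq_eq_toReal_secondMoment {α : Type*} [MeasurableSpace α] {ν : Measure α} {m : α → ℝ}
    (hm : AEMeasurable m ν) : ∫ x, m x ^ 2 ∂ν = (secondMoment ν m).toReal :=
  integral_eq_lintegral_of_nonneg_ae (Filter.Eventually.of_forall fun _ => sq_nonneg _)
    (by fun_prop)

lemma integrable_sq_gaussianReal (m : ℝ) (v : ℝ≥0) :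
    Integrable (fun y => y ^ 2) (gaussianReal m v) :=
  (memLp_two_iff_integrable_sq (by fun_prop)).1 (memLp_id_gaussianReal 2)

lemma integral_sq_gaussianReal (v : ℝ≥0) : ∫ y, y ^ 2 ∂(gaussianReal 0 v) = v := by
  have h := variance_fun_id_gaussianReal (μ := 0) (v := v)
  rw [variance_of_integral_eq_zero (by fun_prop) (by simp)] at h
  simpa using h

lemma secondMoment_gaussianReal (v : ℝ≥0) : secondMoment (gaussianReal 0 v) id = v := by
  have h := integrable_sq_gaussianReal 0 v
  rw [secondMoment]
  simp only [id]
  rw [← ofReal_integral_eq_lintegral_ofReal h (Filter.Eventually.of_forall fun _ => sq_nonneg _),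
    integral_sq_gaussianReal, ENNReal.ofReal_coe_nnreal]

/-! ### Divergence of a Gaussian kernel from a fixed Gaussian output law. -/

section GaussianChannel

variable {α : Type*} [MeasurableSpace α] {m : α → ℝ}

/-- The kernel sending `x` to the law of `m x + Z`, where `Z ∼ 𝓝(0, v)`. -/
noncomputable def gaussianChannel (hm : Measurable m) (v : ℝ≥0) : Kernel α ℝ where
  toFun x := gaussianReal (m x) v
  measurable' := measurable_gaussianReal.comp (hm.prodMk measurable_const)

lemma gaussianChannel_apply (hm : Measurable m) (v : ℝ≥0) (x : α) :
    gaussianChannel hm v x = gaussianReal (m x) v := rfl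

instance (hm : Measurable m) (v : ℝ≥0) : IsMarkovKernel (gaussianChannel hm v) where
  isProbabilityMeasure x := by rw [gaussianChannel_apply]; infer_instance

lemma compProd_gaussianChannel_eq_map (ν : Measure α) [IsProbabilityMeasure ν] (hm : Measurable m)
    (v : ℝ≥0) :
    ν ⊗ₘ gaussianChannel hm v =
      (ν.prod (gaussianReal 0 v)).map (fun p => (p.1, m p.1 + p.2)) := by
  ext s hs
  rw [Measure.compProd_apply hs, Measure.map_apply (by fun_prop) hs,
    Measure.prod_apply (by measurability)]
  refine lintegral_congr fun x => ?_
  have h : gaussianReal (m x) v = (gaussianReal 0 v).map (m x + ·) := by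
    rw [gaussianReal_map_const_add, zero_add]
  rw [gaussianChannel_apply, h, Measure.map_apply (by fun_prop) (by measurability)]
  rfl

lemma compProd_gaussianChannel_eq_withDensity (ν : Measure α) [IsProbabilityMeasure ν]
    (hm : Measurable m) {w v : ℝ≥0} (hw : w ≠ 0) (hv : v ≠ 0) :
    ν ⊗ₘ gaussianChannel hm v = (ν.prod (gaussianReal 0 w)).withDensity
      (fun p => ENNReal.ofReal (Real.exp (gaussianLogRatio w v (m p.1) p.2))) := by
  have hL : Measurable (fun p : α × ℝ => gaussianLogRatio w v (m p.1) p.2) :=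
    (hm.comp measurable_fst).gaussianLogRatio measurable_snd w v
  ext s hs
  rw [Measure.compProd_apply hs, withDensity_apply _ hs, ← lintegral_indicator hs,
    lintegral_prod _ ((Measurable.indicator (by fun_prop) hs).aemeasurable)]
  refine lintegral_congr fun x => ?_
  have hs' : MeasurableSet (Prod.mk x ⁻¹' s) := measurable_prodMk_left hs
  rw [gaussianChannel_apply, gaussianReal_eq_withDensity_gaussianLogRatio hw hv,
    withDensity_apply _ hs', ← lintegral_indicator hs']
  rfl

lemma integral_gaussianLogRatio_compProd (ν : Measure α) [IsProbabilityMeasure ν]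
    (hm : Measurable m) (h2 : secondMoment ν m ≠ ⊤) {w v : ℝ≥0} (hv : v ≠ 0) :
    Integrable (fun p : α × ℝ => gaussianLogRatio w v (m p.1) p.2) (ν ⊗ₘ gaussianChannel hm v) ∧
    ∫ p, gaussianLogRatio w v (m p.1) p.2 ∂(ν ⊗ₘ gaussianChannel hm v) =
      Real.log ((w : ℝ) / v) / 2 - 1 / 2 + ((secondMoment ν m).toReal + v) / (2 * w) := by
  have hL : Measurable (fun p : α × ℝ => gaussianLogRatio w v (m p.1) p.2) :=
    (hm.comp measurable_fst).gaussianLogRatio measurable_snd w v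
  have hmap : Measurable (fun p : α × ℝ => (p.1, m p.1 + p.2)) := by fun_prop
  rw [compProd_gaussianChannel_eq_map, integrable_map_measure hL.aestronglyMeasurable
    hmap.aemeasurable, integral_map hmap.aemeasurable hL.aestronglyMeasurable]
  have hm2 : Integrable (fun x => m x ^ 2) ν :=
    integrable_sq_of_secondMoment_ne_top hm.aemeasurable h2
  have hm1 : Integrable m ν := integrable_of_integrable_sq hm.aestronglyMeasurable hm2
  have hz2 := integrable_sq_gaussianReal 0 v
  have hz1 : Integrable (fun z : ℝ => z) (gaussianReal 0 v) :=
    integrable_of_integrable_sq (by fun_prop) hz2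
  have i1 : Integrable (fun p : α × ℝ => m p.1 ^ 2) (ν.prod (gaussianReal 0 v)) := hm2.comp_fst _
  have i2 : Integrable (fun p : α × ℝ => p.2 ^ 2) (ν.prod (gaussianReal 0 v)) := hz2.comp_snd _
  have i3 : Integrable (fun p : α × ℝ => m p.1 * p.2) (ν.prod (gaussianReal 0 v)) :=
    hm1.mul_prod hz1
  have e1 : ∫ p : α × ℝ, m p.1 ^ 2 ∂(ν.prod (gaussianReal 0 v)) = (secondMoment ν m).toReal := by
    rw [integral_fun_fst (fun x => m x ^ 2), integral_sq_eq_toReal_secondMoment hm.aemeasurable]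
    simp
  have e2 : ∫ p : α × ℝ, p.2 ^ 2 ∂(ν.prod (gaussianReal 0 v)) = v := by
    rw [integral_fun_snd (fun z : ℝ => z ^ 2), integral_sq_gaussianReal]
    simp
  have e3 : ∫ p : α × ℝ, m p.1 * p.2 ∂(ν.prod (gaussianReal 0 v)) = 0 := by
    rw [integral_prod_mul m (fun z : ℝ => z)]
    simp
  -- With `y = m + z` the log-ratio is a quadratic in `m` and `z`, whose cross term has mean zero
  -- because `z` is centred and independent of `m`.
  have key : ((fun p : α × ℝ => gaussianLogRatio w v (m p.1) p.2) ∘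
      fun p : α × ℝ => (p.1, m p.1 + p.2)) = fun p => Real.log ((w : ℝ) / v) / 2 +
        (((1 / (2 * w) - 1 / (2 * v) : ℝ) * p.2 ^ 2 + (1 / (2 * w) : ℝ) * m p.1 ^ 2) +
          (1 / w : ℝ) * (m p.1 * p.2)) := by
    funext p
    simp only [gaussianLogRatio, Function.comp]
    ring
  have i4 : Integrable (fun p : α × ℝ => (1 / (2 * w) - 1 / (2 * v) : ℝ) * p.2 ^ 2 +
      (1 / (2 * w) : ℝ) * m p.1 ^ 2) (ν.prod (gaussianReal 0 v)) :=
    (i2.const_mul _).add (i1.const_mul _)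
  have i5 : Integrable (fun p : α × ℝ => ((1 / (2 * w) - 1 / (2 * v) : ℝ) * p.2 ^ 2 +
      (1 / (2 * w) : ℝ) * m p.1 ^ 2) + (1 / w : ℝ) * (m p.1 * p.2))
      (ν.prod (gaussianReal 0 v)) := i4.add (i3.const_mul _)
  refine ⟨?_, ?_⟩
  · rw [key]
    exact (integrable_const _).add i5
  · change ∫ p, ((fun p : α × ℝ => gaussianLogRatio w v (m p.1) p.2) ∘
      fun p : α × ℝ => (p.1, m p.1 + p.2)) p ∂_ = _
    rw [key, integral_add (integrable_const _) i5, integral_add i4 (i3.const_mul _),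
      integral_add (i2.const_mul _) (i1.const_mul _), integral_const_mul, integral_const_mul,
      integral_const_mul, e1, e2, e3]
    have : (v : ℝ) ≠ 0 := by exact_mod_cast hv
    simp
    field_simp
    ring

lemma klDiv_compProd_gaussianChannel (ν : Measure α) [IsProbabilityMeasure ν]
    (hm : Measurable m) (h2 : secondMoment ν m ≠ ⊤) {w v : ℝ≥0} (hw : w ≠ 0) (hv : v ≠ 0) :
    InformationTheory.klDiv (ν ⊗ₘ gaussianChannel hm v) (ν.prod (gaussianReal 0 w)) =
      ENNReal.ofReal (Real.log ((w : ℝ) / v) / 2 - 1 / 2 +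
        ((secondMoment ν m).toReal + v) / (2 * w)) := by
  have hL : Measurable (fun p : α × ℝ => gaussianLogRatio w v (m p.1) p.2) :=
    (hm.comp measurable_fst).gaussianLogRatio measurable_snd w v
  obtain ⟨hint, heq⟩ := integral_gaussianLogRatio_compProd ν hm h2 (w := w) hv
  have hwd := compProd_gaussianChannel_eq_withDensity ν hm hw hv
  have hac : ν ⊗ₘ gaussianChannel hm v ≪ ν.prod (gaussianReal 0 w) := by
    rw [hwd]
    exact withDensity_absolutelyContinuous _ _
  have hllr : llr (ν ⊗ₘ gaussianChannel hm v) (ν.prod (gaussianReal 0 w))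
      =ᵐ[ν ⊗ₘ gaussianChannel hm v] fun p => gaussianLogRatio w v (m p.1) p.2 := by
    have h : (ν ⊗ₘ gaussianChannel hm v).rnDeriv (ν.prod (gaussianReal 0 w))
        =ᵐ[ν.prod (gaussianReal 0 w)]
          fun p => ENNReal.ofReal (Real.exp (gaussianLogRatio w v (m p.1) p.2)) := by
      rw [hwd]
      exact Measure.rnDeriv_withDensity _ (by fun_prop)
    filter_upwards [hac.ae_le h] with p hp
    rw [llr, hp, ENNReal.toReal_ofReal (Real.exp_pos _).le, Real.log_exp]
  rw [InformationTheory.klDiv_of_ac_of_integrable hac ((integrable_congr hllr).2 hint),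
    integral_congr_ae hllr, heq]
  simp

/-- With reference variance `P + N`, the power constraint bounds the quadratic term by `1/2`, which
the `-1/2` absorbs; only the logarithm survives. -/
lemma klDiv_compProd_gaussianChannel_le (ν : Measure α) [IsProbabilityMeasure ν]
    (hm : Measurable m) {P N : ℝ≥0} (hP : secondMoment ν m ≤ P) (hN : N ≠ 0) :
    InformationTheory.klDiv (ν ⊗ₘ gaussianChannel hm N) (ν.prod (gaussianReal 0 (P + N))) ≤
      ENNReal.ofReal (Real.log (1 + (P : ℝ) / N) / 2) := by
  have hw : P + N ≠ 0 := by positivity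
  have hN' : (0 : ℝ) < N := by positivity
  have hP' : (secondMoment ν m).toReal ≤ P := ENNReal.toReal_le_coe_of_le_coe hP
  rw [klDiv_compProd_gaussianChannel ν hm (ne_top_of_le_ne_top ENNReal.coe_ne_top hP) hw hN]
  refine ENNReal.ofReal_le_ofReal ?_
  have h1 : ((P + N : ℝ≥0) : ℝ) / N = 1 + P / N := by push_cast; field_simp; ring
  have h2 : ((secondMoment ν m).toReal + N) / (2 * ((P + N : ℝ≥0) : ℝ)) ≤ 1 / 2 := by
    have : (0 : ℝ) < ((P + N : ℝ≥0) : ℝ) := by positivity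
    rw [div_le_div_iff₀ (by positivity) two_pos]
    push_cast
    linarith
  rw [h1]
  linarith

end GaussianChannel

/-! ### Variational bounds on mutual information. -/

/-- Mutual information is at most the divergence from `ρ.fst.prod Q`, whatever the law `Q`. -/
lemma klDiv_prod_marginals_le {α β : Type*} [MeasurableSpace α] [StandardBorelSpace α] [Nonempty α]
    [MeasurableSpace β] (ρ : Measure (α × β)) [IsProbabilityMeasure ρ] (Q : Measure β)
    [IsProbabilityMeasure Q] :
    InformationTheory.klDiv ρ (ρ.fst.prod ρ.snd) ≤ InformationTheory.klDiv ρ (ρ.fst.prod Q) := by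
  have hK : ρ.snd ⊗ₘ (ρ.map Prod.swap).condKernel = ρ.map Prod.swap := by
    have : IsFiniteMeasure (ρ.map Prod.swap) := inferInstance
    rw [← Measure.fst_map_swap]
    exact (ρ.map Prod.swap).disintegrate _
  have hρ : (ρ.map Prod.swap).map Prod.swap = ρ := by
    rw [Measure.map_map measurable_swap measurable_swap, Prod.swap_swap_eq, Measure.map_id]
  calc InformationTheory.klDiv ρ (ρ.fst.prod ρ.snd)
      = InformationTheory.klDiv ((ρ.map Prod.swap).map Prod.swap)
          ((ρ.snd.prod ρ.fst).map Prod.swap) := by rw [hρ, Measure.prod_swap]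
    _ ≤ InformationTheory.klDiv (ρ.map Prod.swap) (ρ.snd.prod ρ.fst) :=
        InformationTheory.klDiv_map_le _ _ measurable_swap
    _ ≤ InformationTheory.klDiv (ρ.map Prod.swap) (Q.prod ρ.fst) := by
        -- After the swap the chain rule splits off the second marginal: the two sides differ by the
        -- divergence of `ρ.snd` from `Q`.
        rw [← hK, ← Measure.compProd_const, ← Measure.compProd_const,
          InformationTheory.klDiv_compProd_eq_add ρ.snd Q]
        exact le_add_self
    _ = InformationTheory.klDiv (ρ.map Prod.swap) ((ρ.fst.prod Q).map Prod.swap) := by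
        rw [Measure.prod_swap]
    _ ≤ InformationTheory.klDiv ρ (ρ.fst.prod Q) :=
        InformationTheory.klDiv_map_le _ _ measurable_swap

/-- The Shannon lower bound for a Gaussian source under quadratic distortion, in nats. -/
lemma log_div_le_toReal_klDiv (ρ : Measure (ℝ × ℝ)) [IsProbabilityMeasure ρ] {w t : ℝ≥0}
    (hw : w ≠ 0) (ht : t ≠ 0) (hfst : ρ.fst = gaussianReal 0 w)
    (hD : secondMoment ρ (fun p => p.1 - p.2) ≤ t)
    (hfin : InformationTheory.klDiv ρ (ρ.fst.prod ρ.snd) ≠ ⊤) :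
    Real.log ((w : ℝ) / t) / 2 ≤ (InformationTheory.klDiv ρ (ρ.fst.prod ρ.snd)).toReal := by
  obtain ⟨hac, hllr⟩ := InformationTheory.klDiv_ne_top_iff.1 hfin
  rw [InformationTheory.toReal_klDiv_of_measure_eq hac (by simp)]
  set ν := ρ.fst.prod ρ.snd with hν
  -- Reverse test channel: the source is modelled as the reconstruction `p.2` plus Gaussian error of
  -- variance `t`.
  have hfm : Measurable (fun p : ℝ × ℝ => gaussianLogRatio w t p.2 p.1) :=
    measurable_snd.gaussianLogRatio measurable_fst w t
  have hlint : ∫⁻ p : ℝ × ℝ, ENNReal.ofReal (Real.exp (gaussianLogRatio w t p.2 p.1)) ∂ν = 1 := by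
    rw [hν, hfst, lintegral_prod_symm _ hfm.exp.ennreal_ofReal.aemeasurable]
    simp [lintegral_exp_gaussianLogRatio hw ht]
  have hexp : Integrable (fun p : ℝ × ℝ => Real.exp (gaussianLogRatio w t p.2 p.1)) ν := by
    refine (lintegral_ofReal_ne_top_iff_integrable hfm.exp.aestronglyMeasurable
      (Filter.Eventually.of_forall fun _ => (Real.exp_pos _).le)).1 ?_
    rw [hlint]
    exact ENNReal.one_ne_top
  have hexp1 : ∫ p : ℝ × ℝ, Real.exp (gaussianLogRatio w t p.2 p.1) ∂ν = 1 := by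
    rw [integral_eq_lintegral_of_nonneg_ae
      (Filter.Eventually.of_forall fun _ => (Real.exp_pos _).le) hfm.exp.aestronglyMeasurable, hlint]
    simp
  have hD2 : Integrable (fun p : ℝ × ℝ => (p.1 - p.2) ^ 2) ρ :=
    integrable_sq_of_secondMoment_ne_top (by fun_prop) (ne_top_of_le_ne_top ENNReal.coe_ne_top hD)
  have hDle : ∫ p : ℝ × ℝ, (p.1 - p.2) ^ 2 ∂ρ ≤ t := by
    rw [integral_sq_eq_toReal_secondMoment (by fun_prop)]
    exact ENNReal.toReal_le_coe_of_le_coe hD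
  have hA2 : Integrable (fun p : ℝ × ℝ => p.1 ^ 2) ρ := by
    have h := integrable_sq_gaussianReal 0 w
    rw [← hfst, Measure.fst] at h
    exact h.comp_measurable measurable_fst
  have hA : ∫ p : ℝ × ℝ, p.1 ^ 2 ∂ρ = w := by
    have h := integral_sq_gaussianReal w
    rwa [← hfst, Measure.fst, integral_map (by fun_prop) (by fun_prop)] at h
  have i1 : Integrable (fun p : ℝ × ℝ => Real.log ((w : ℝ) / t) / 2 - (p.1 - p.2) ^ 2 / (2 * t)) ρ :=
    (integrable_const _).sub (hD2.div_const _)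
  have hf : Integrable (fun p : ℝ × ℝ => gaussianLogRatio w t p.2 p.1) ρ :=
    i1.add (hA2.div_const _)
  have hfint : Real.log ((w : ℝ) / t) / 2 ≤ ∫ p : ℝ × ℝ, gaussianLogRatio w t p.2 p.1 ∂ρ := by
    unfold gaussianLogRatio
    rw [integral_add i1 (hA2.div_const _), integral_sub (integrable_const _) (hD2.div_const _),
      integral_div _ (fun p : ℝ × ℝ => (p.1 - p.2) ^ 2), integral_div _ (fun p : ℝ × ℝ => p.1 ^ 2),
      hA]
    have hw' : (0 : ℝ) < w := by positivity
    have ht' : (0 : ℝ) < t := by positivity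
    have h1 : (∫ p : ℝ × ℝ, (p.1 - p.2) ^ 2 ∂ρ) / (2 * t) ≤ 1 / 2 := by
      rw [div_le_div_iff₀ (by positivity) two_pos]
      linarith
    have h2 : (w : ℝ) / (2 * w) = 1 / 2 := by field_simp
    rw [h2]
    simp only [integral_const, probReal_univ, smul_eq_mul, one_mul]
    linarith
  -- Nonnegativity of the divergence of `ρ` from the tilted measure bounds the mean of the test
  -- function; the normalisation is `log 1 = 0`.
  have : IsProbabilityMeasure (ν.tilted fun p => gaussianLogRatio w t p.2 p.1) :=
    isProbabilityMeasure_tilted hexp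
  have hgibbs := InformationTheory.integral_llr_add_sub_measure_univ_nonneg
    (hac.trans (absolutelyContinuous_tilted hexp)) (integrable_llr_tilted_right hac hf hllr hexp)
  rw [integral_llr_tilted_right hac hf hexp hllr, hexp1] at hgibbs
  simp only [Real.log_one, probReal_univ] at hgibbs
  linarith

/-! ### Unrolling the feedback loop. -/

lemma IndepFun.prodMk_left_of_prodMk_right {Ω α β γ : Type*} [MeasurableSpace Ω]
    [MeasurableSpace α] [MeasurableSpace β] [MeasurableSpace γ] {μ : Measure Ω}
    [IsProbabilityMeasure μ] {A : Ω → α} {U : Ω → β} {V : Ω → γ} (hA : Measurable A)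
    (hU : Measurable U) (hV : Measurable V) (h : IndepFun A (fun ω => (U ω, V ω)) μ)
    (hUV : IndepFun U V μ) : IndepFun (fun ω => (A ω, U ω)) V μ := by
  have := Measure.isProbabilityMeasure_map (μ := μ) hA.aemeasurable
  have := Measure.isProbabilityMeasure_map (μ := μ) hU.aemeasurable
  have := Measure.isProbabilityMeasure_map (μ := μ) hV.aemeasurable
  have hAU : IndepFun A U μ := h.comp measurable_id measurable_fst
  rw [indepFun_iff_map_prod_eq_prod_map_map (by fun_prop) (by fun_prop)] at h hUV hAU ⊢
  rw [hAU]
  rw [hUV, ← Measure.prodAssoc_prod] at h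
  have h' := congrArg (Measure.map MeasurableEquiv.prodAssoc.symm) h
  rw [Measure.map_map (by fun_prop) (by fun_prop), Measure.map_map (by fun_prop) (by fun_prop)] at h'
  rw [MeasurableEquiv.symm_comp_self, Measure.map_id] at h'
  exact h'

lemma measurable_fin_snoc {k : ℕ} :
    Measurable (fun p : (Fin k → ℝ) × ℝ => (Fin.snoc p.1 p.2 : Fin (k + 1) → ℝ)) := by
  refine measurable_pi_iff.2 fun i => ?_
  refine Fin.lastCases ?_ (fun j => ?_) i
  · simpa using measurable_snd
  · simp only [Fin.snoc_castSucc]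
    fun_prop

/-- The data from which the channel input number `k` is computed: the source and the past channel
outputs. -/
def channelPast {Ω : Type*} (A : Ω → ℝ) (Y : ℕ → Ω → ℝ) (k : ℕ) (ω : Ω) : ℝ × (Fin k → ℝ) :=
  (A ω, fun j => Y j ω)

/-- The map from the source and the past channel outputs to the channel input. -/
def composedEncoder (f : (i : ℕ) → ℝ × (Fin i → ℝ) → ℝ) (g : (i : ℕ) → (Fin (i + 1) → ℝ) → ℝ)
    (k : ℕ) (p : ℝ × (Fin k → ℝ)) : ℝ :=
  f k (p.1, fun j => g j fun i => p.2 ⟨i, by omega⟩)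

lemma channelPast_succ {Ω : Type*} (A : Ω → ℝ) (Y : ℕ → Ω → ℝ) (k : ℕ) (ω : Ω) :
    channelPast A Y (k + 1) ω =
      ((channelPast A Y k ω).1, Fin.snoc (channelPast A Y k ω).2 (Y k ω)) := by
  refine Prod.ext rfl ?_
  funext i
  refine Fin.lastCases ?_ (fun j => ?_) i <;> simp [channelPast]

namespace IsFeedbackTransmission

variable {Ω : Type*} [MeasurableSpace Ω] {μ : Measure Ω} {n : ℕ} {σ₀ P N : ℝ≥0}
  {f : (i : ℕ) → ℝ × (Fin i → ℝ) → ℝ} {g : (i : ℕ) → (Fin (i + 1) → ℝ) → ℝ}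
  {A : Ω → ℝ} {X Y Z Ahat : ℕ → Ω → ℝ}

lemma measurable_composedEncoder (h : IsFeedbackTransmission μ n σ₀ P N f g A X Y Z Ahat) {k : ℕ}
    (hk : k < n) : Measurable (composedEncoder f g k) := by
  refine (h.measurable_encoder k hk).comp (measurable_fst.prodMk (measurable_pi_iff.2 fun j => ?_))
  exact (h.measurable_decoder j (by omega)).comp (by fun_prop)

lemma input_eq (h : IsFeedbackTransmission μ n σ₀ P N f g A X Y Z Ahat) {k : ℕ} (hk : k < n)
    (ω : Ω) : X k ω = composedEncoder f g k (channelPast A Y k ω) := by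
  rw [h.encode k hk, composedEncoder, channelPast]
  congr 2
  funext j
  exact h.decode j (by omega) ω

/-- Causality: the past at time `k` involves only the noises of index below `k`, which is what makes
it independent of `Z k`. -/
lemma exists_channelPast_eq (h : IsFeedbackTransmission μ n σ₀ P N f g A X Y Z Ahat) {k : ℕ}
    (hk : k ≤ n) : ∃ Φ : ℝ × (Fin k → ℝ) → ℝ × (Fin k → ℝ), Measurable Φ ∧
      ∀ ω, channelPast A Y k ω = Φ (channelPast A Z k ω) := by
  induction k with
  | zero => exact ⟨id, measurable_id, fun ω => Prod.ext rfl (Subsingleton.elim _ _)⟩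
  | succ k ih =>
    obtain ⟨Φ, hΦ, hΦeq⟩ := ih (by omega)
    have hm := h.measurable_composedEncoder (k := k) (by omega)
    have hr : Measurable fun p : ℝ × (Fin (k + 1) → ℝ) =>
        ((p.1, fun j : Fin k => p.2 j.castSucc) : ℝ × (Fin k → ℝ)) := by fun_prop
    refine ⟨fun p => ((Φ (p.1, fun j => p.2 j.castSucc)).1,
      Fin.snoc (Φ (p.1, fun j => p.2 j.castSucc)).2
        (composedEncoder f g k (Φ (p.1, fun j => p.2 j.castSucc)) + p.2 (Fin.last k))), ?_, ?_⟩
    · have hΦr := hΦ.comp hr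
      exact (measurable_fst.comp hΦr).prodMk (measurable_fin_snoc.comp
        ((measurable_snd.comp hΦr).prodMk ((hm.comp hΦr).add (by fun_prop))))
    · intro ω
      rw [channelPast_succ, h.channel k (by omega), h.input_eq (by omega), hΦeq]
      rfl

lemma measurable_channelPast (h : IsFeedbackTransmission μ n σ₀ P N f g A X Y Z Ahat) {k : ℕ}
    (hk : k ≤ n) : Measurable (channelPast A Y k) := by
  obtain ⟨Φ, hΦ, hΦeq⟩ := h.exists_channelPast_eq hk
  rw [funext hΦeq]
  refine hΦ.comp (h.measurable_source.prodMk (measurable_pi_iff.2 fun j => ?_))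
  exact h.measurable_noise j (by omega)

lemma indepFun_channelPast_noise [IsProbabilityMeasure μ]
    (h : IsFeedbackTransmission μ n σ₀ P N f g A X Y Z Ahat) {k : ℕ}
    (hk : k < n) : IndepFun (channelPast A Y k) (Z k) μ := by
  obtain ⟨Φ, hΦ, hΦeq⟩ := h.exists_channelPast_eq hk.le
  rw [funext hΦeq]
  have hU : Measurable fun ω => fun j : Fin k => Z j ω :=
    measurable_pi_iff.2 fun j => h.measurable_noise j (by omega)
  have hUV : IndepFun (fun ω => fun j : Fin k => Z j ω) (Z k) μ := by
    have hfin := h.indep_noise.indepFun_finset (Finset.univ.filter fun i : Fin n => (i : ℕ) < k)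
      {⟨k, hk⟩} (by simp) fun i => h.measurable_noise i i.2
    have hφ : Measurable fun (z : (Finset.univ.filter fun i : Fin n => (i : ℕ) < k) → ℝ)
        (j : Fin k) => z ⟨⟨j, by omega⟩, by simp⟩ := by fun_prop
    have hψ : Measurable fun z : ({⟨k, hk⟩} : Finset (Fin n)) → ℝ => z ⟨⟨k, hk⟩, by simp⟩ := by
      fun_prop
    exact hfin.comp hφ hψ
  have hA : IndepFun A (fun ω => ((fun j : Fin k => Z j ω), Z k ω)) μ :=
    h.indep_source_noise.comp (φ := id)
      (ψ := fun z : Fin n → ℝ => ((fun j : Fin k => z ⟨j, by omega⟩), z ⟨k, hk⟩))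
      measurable_id (by fun_prop)
  exact (IndepFun.prodMk_left_of_prodMk_right h.measurable_source hU (h.measurable_noise k hk)
    hA hUV).comp hΦ measurable_id

lemma map_channelPast_succ [IsProbabilityMeasure μ]
    (h : IsFeedbackTransmission μ n σ₀ P N f g A X Y Z Ahat) {k : ℕ} (hk : k < n) :
    μ.map (channelPast A Y (k + 1)) =
      (μ.map (channelPast A Y k) ⊗ₘ gaussianChannel (h.measurable_composedEncoder hk) N).map
        (fun q => (q.1.1, Fin.snoc q.1.2 q.2)) := by
  have hp := h.measurable_channelPast hk.le
  have hZ := h.measurable_noise k hk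
  have hm := h.measurable_composedEncoder hk
  have := Measure.isProbabilityMeasure_map (μ := μ) hp.aemeasurable
  have hs : Measurable fun q : (ℝ × (Fin k → ℝ)) × ℝ =>
      ((q.1.1, Fin.snoc q.1.2 q.2) : ℝ × (Fin (k + 1) → ℝ)) :=
    (measurable_fst.comp measurable_fst).prodMk (measurable_fin_snoc.comp
      ((measurable_snd.comp measurable_fst).prodMk measurable_snd))
  rw [compProd_gaussianChannel_eq_map, ← h.law_noise k hk,
    ← (indepFun_iff_map_prod_eq_prod_map_map hp.aemeasurable hZ.aemeasurable).1
      (h.indepFun_channelPast_noise hk), Measure.map_map hs (by fun_prop),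
    Measure.map_map (hs.comp (by fun_prop)) (by fun_prop)]
  congr 1
  funext ω
  rw [channelPast_succ, h.channel k hk, h.input_eq hk]
  rfl

lemma secondMoment_composedEncoder [IsProbabilityMeasure μ]
    (h : IsFeedbackTransmission μ n σ₀ P N f g A X Y Z Ahat) {k : ℕ} (hk : k < n) :
    secondMoment (μ.map (channelPast A Y k)) (composedEncoder f g k) ≤ P := by
  have hm := h.measurable_composedEncoder hk
  rw [secondMoment, lintegral_map (by fun_prop) (h.measurable_channelPast hk.le)]
  simpa only [secondMoment, h.input_eq hk] using h.power k hk

/-- The source and the first `k` channel outputs are within `k` times the single-use capacity of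
some product law with the same source marginal. -/
lemma exists_klDiv_channelPast_le [IsProbabilityMeasure μ]
    (h : IsFeedbackTransmission μ n σ₀ P N f g A X Y Z Ahat) (hN : N ≠ 0) {k : ℕ} (hk : k ≤ n) :
    ∃ Q : Measure (Fin k → ℝ), IsProbabilityMeasure Q ∧
      InformationTheory.klDiv (μ.map (channelPast A Y k)) ((μ.map A).prod Q) ≤
        k * ENNReal.ofReal (Real.log (1 + (P : ℝ) / N) / 2) := by
  have hA := h.measurable_source
  have := Measure.isProbabilityMeasure_map (μ := μ) hA.aemeasurable
  induction k with
  | zero =>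
    refine ⟨Measure.dirac 0, inferInstance, ?_⟩
    have heq : channelPast A Y 0 = fun ω => (A ω, 0) :=
      funext fun ω => Prod.ext rfl (Subsingleton.elim _ _)
    have hprod : (μ.map A).prod (Measure.dirac (0 : Fin 0 → ℝ)) = μ.map (channelPast A Y 0) := by
      rw [Measure.prod_dirac, Measure.map_map (by fun_prop) hA, heq]
      rfl
    have := Measure.isProbabilityMeasure_map (μ := μ) (h.measurable_channelPast hk).aemeasurable
    rw [hprod, InformationTheory.klDiv_self]
    exact zero_le
  | succ k ih =>
    obtain ⟨Q, hQ, hle⟩ := ih (by omega)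
    have := Measure.isProbabilityMeasure_map (μ := μ)
      (h.measurable_channelPast (k := k) (by omega)).aemeasurable
    have hs : Measurable fun q : (ℝ × (Fin k → ℝ)) × ℝ =>
        ((q.1.1, Fin.snoc q.1.2 q.2) : ℝ × (Fin (k + 1) → ℝ)) :=
      (measurable_fst.comp measurable_fst).prodMk (measurable_fin_snoc.comp
        ((measurable_snd.comp measurable_fst).prodMk measurable_snd))
    -- The new reference law appends an independent `𝓝(0, P + N)` coordinate to `Q`.
    have href : (μ.map A).prod ((Q.prod (gaussianReal 0 (P + N))).map
        (fun p : (Fin k → ℝ) × ℝ => (Fin.snoc p.1 p.2 : Fin (k + 1) → ℝ))) =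
        (((μ.map A).prod Q).prod (gaussianReal 0 (P + N))).map
          (fun q => (q.1.1, Fin.snoc q.1.2 q.2)) := by
      conv_lhs => rw [← Measure.map_id (μ := μ.map A)]
      rw [Measure.map_prod_map _ _ measurable_id measurable_fin_snoc, ← Measure.prodAssoc_prod,
        Measure.map_map (measurable_id.prodMap measurable_fin_snoc) (by fun_prop)]
      rfl
    refine ⟨_, Measure.isProbabilityMeasure_map (μ := Q.prod (gaussianReal 0 (P + N)))
      measurable_fin_snoc.aemeasurable, ?_⟩
    rw [href, h.map_channelPast_succ (by omega)]
    refine (InformationTheory.klDiv_map_le _ _ hs).trans ?_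
    rw [← Measure.compProd_const, InformationTheory.klDiv_compProd_eq_add, Measure.compProd_const,
      Nat.cast_succ, add_mul, one_mul]
    exact add_le_add hle (klDiv_compProd_gaussianChannel_le _ _
      (h.secondMoment_composedEncoder (by omega)) hN)

end IsFeedbackTransmission

/-! ### Capacity, distortion bound in bits, and conclusion. -/

lemma mutualInfoBits_le_of_klDiv_le {Ω α β : Type*} [MeasurableSpace Ω] [MeasurableSpace α]
    [StandardBorelSpace α] [Nonempty α] [MeasurableSpace β] {μ : Measure Ω}
    [IsProbabilityMeasure μ] {X : Ω → α} {Y : Ω → β} (hX : Measurable X) (hY : Measurable Y)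
    (Q : Measure β) [IsProbabilityMeasure Q] {c : ℝ≥0∞}
    (h : InformationTheory.klDiv (μ.map (fun ω => (X ω, Y ω))) ((μ.map X).prod Q) ≤ c) :
    mutualInfoBits μ X Y ≤ c / ENNReal.ofReal (Real.log 2) := by
  have := Measure.isProbabilityMeasure_map (μ := μ) (hX.prodMk hY).aemeasurable
  have hle := klDiv_prod_marginals_le (μ.map (fun ω => (X ω, Y ω))) Q
  rw [Measure.fst_map_prodMk hY, Measure.snd_map_prodMk hX] at hle
  exact ENNReal.div_le_div_right (hle.trans h) _

lemma map_prod_gaussianReal_eq_compProd (p : Measure ℝ) [IsProbabilityMeasure p] (N : ℝ≥0) :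
    (p.prod (gaussianReal 0 N)).map (fun w => (w.1, w.1 + w.2)) =
      p ⊗ₘ gaussianChannel measurable_id N :=
  (compProd_gaussianChannel_eq_map p measurable_id N).symm

lemma awgnCapacity_eq_ofReal_div (P : ℝ≥0) {N : ℝ≥0} (hN : N ≠ 0) :
    awgnCapacity P N =
      ENNReal.ofReal (Real.log (1 + (P : ℝ) / N) / 2) / ENNReal.ofReal (Real.log 2) := by
  refine le_antisymm (iSup_le fun p => iSup_le fun hp => iSup_le fun hP => ?_) ?_
  · refine mutualInfoBits_le_of_klDiv_le measurable_fst (by fun_prop) (gaussianReal 0 (P + N)) ?_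
    rw [map_prod_gaussianReal_eq_compProd]
    simpa using klDiv_compProd_gaussianChannel_le p measurable_id hP hN
  · refine le_iSup_of_le (gaussianReal 0 P) (le_iSup_of_le inferInstance
      (le_iSup_of_le (secondMoment_gaussianReal P).le ?_))
    have hsum : ((gaussianReal 0 P).prod (gaussianReal 0 N)).map (fun w => w.1 + w.2) =
        gaussianReal 0 (P + N) := by
      have h := gaussianReal_conv_gaussianReal (m₁ := 0) (m₂ := 0) (v₁ := P) (v₂ := N)
      rwa [add_zero, Measure.conv] at h
    have hfst : ((gaussianReal 0 P).prod (gaussianReal 0 N)).map (fun w => w.1) =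
        gaussianReal 0 P := by
      rw [show (fun w : ℝ × ℝ => w.1) = Prod.fst from rfl, Measure.map_fst_prod]
      simp
    have hw : P + N ≠ 0 := by positivity
    rw [mutualInfoBits, hsum, hfst, map_prod_gaussianReal_eq_compProd,
      klDiv_compProd_gaussianChannel _ measurable_id
        (by rw [secondMoment_gaussianReal]; exact ENNReal.coe_ne_top) hw hN,
      secondMoment_gaussianReal]
    refine le_of_eq ?_
    congr 2
    have hN' : (0 : ℝ) < N := by positivity
    have h1 : ((P + N : ℝ≥0) : ℝ) / N = 1 + P / N := by push_cast; field_simp; ring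
    rw [h1, ENNReal.coe_toReal]
    have h2 : ((P : ℝ) + N) / (2 * ((P + N : ℝ≥0) : ℝ)) = 1 / 2 := by push_cast; field_simp
    rw [h2]
    ring

lemma half_mul_elogb2_le_mutualInfoBits {Ω : Type*} [MeasurableSpace Ω] {μ : Measure Ω}
    [IsProbabilityMeasure μ] {A B : Ω → ℝ} (hA : Measurable A) (hB : Measurable B) {w : ℝ≥0}
    (hw : w ≠ 0) (hlaw : μ.map A = gaussianReal 0 w) :
    ((1 / 2 : ℝ) : EReal) * elogb2 ((w : ℝ≥0∞) / secondMoment μ (fun ω => A ω - B ω)) ≤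
      ((mutualInfoBits μ A B : ℝ≥0∞) : EReal) := by
  have hlog2 : 0 < Real.log 2 := Real.log_pos one_lt_two
  have := Measure.isProbabilityMeasure_map (μ := μ) (hA.prodMk hB).aemeasurable
  set K := InformationTheory.klDiv (μ.map (fun ω => (A ω, B ω))) ((μ.map A).prod (μ.map B)) with hK
  by_cases hfin : K = ⊤
  · have : mutualInfoBits μ A B = ⊤ := by
      rw [mutualInfoBits, ← hK, hfin, ENNReal.top_div_of_ne_top ENNReal.ofReal_ne_top]
    rw [this]
    exact le_top
  -- Allowing every positive `t` above the distortion, not just the distortion itself, also covers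
  -- zero distortion.
  have hbound : ∀ t : ℝ≥0, t ≠ 0 → secondMoment μ (fun ω => A ω - B ω) ≤ t →
      Real.log ((w : ℝ) / t) / 2 ≤ K.toReal := by
    intro t ht hD
    have h := log_div_le_toReal_klDiv (μ.map (fun ω => (A ω, B ω))) hw ht
      (by rw [Measure.fst_map_prodMk hB, hlaw])
      (by rwa [secondMoment, lintegral_map (by fun_prop) (by fun_prop)])
    rw [Measure.fst_map_prodMk hB, Measure.snd_map_prodMk hA] at h
    exact h hfin
  have hI : ((mutualInfoBits μ A B : ℝ≥0∞) : EReal) = ((K.toReal / Real.log 2 : ℝ) : EReal) := by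
    rw [mutualInfoBits, ← hK, ← ENNReal.ofReal_toReal hfin,
      ← ENNReal.ofReal_div_of_pos hlog2, EReal.coe_ennreal_ofReal, ENNReal.toReal_ofReal (by simp),
      max_eq_left (by positivity)]
  by_cases hDtop : secondMoment μ (fun ω => A ω - B ω) = ⊤
  · rw [hDtop, ENNReal.div_top, elogb2, ENNReal.log_zero,
      EReal.bot_div_of_pos_ne_top (by exact_mod_cast hlog2) (EReal.coe_ne_top _),
      EReal.coe_mul_bot_of_pos (by norm_num)]
    exact bot_le
  lift secondMoment μ (fun ω => A ω - B ω) to ℝ≥0 using hDtop with D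
  have hw' : (0 : ℝ) < w := by positivity
  have hD0 : D ≠ 0 := by
    rintro rfl
    -- This `t` turns the bound into `K + 1 ≤ K`: zero distortion needs infinite information.
    have h := hbound (w * (Real.exp (-(2 * K.toReal + 2))).toNNReal)
      (mul_ne_zero hw (Real.toNNReal_pos.2 (Real.exp_pos _)).ne') (by simp)
    rw [NNReal.coe_mul, Real.coe_toNNReal _ (Real.exp_pos _).le, div_mul_cancel_left₀ hw'.ne', ← Real.exp_neg,
      Real.log_exp] at h
    linarith
  have hD' : (0 : ℝ) < D := by positivity
  rw [hI, elogb2, ← ENNReal.coe_div hD0, ENNReal.log_of_nnreal (div_ne_zero hw hD0),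
    ← EReal.coe_div, ← EReal.coe_mul, EReal.coe_le_coe_iff, NNReal.coe_div, ← mul_div_assoc]
  refine div_le_div_of_nonneg_right ?_ hlog2.le
  linarith [hbound D hD0 le_rfl]

theorem theorem1 {Ω : Type*} [MeasurableSpace Ω] (μ : Measure Ω) [IsProbabilityMeasure μ]
    (n : ℕ) (hn : 0 < n) (σ₀ P N : ℝ≥0) (hσ₀ : 0 < σ₀) (hN : 0 < N)
    (f : (i : ℕ) → ℝ × (Fin i → ℝ) → ℝ) (g : (i : ℕ) → (Fin (i + 1) → ℝ) → ℝ)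
    (A : Ω → ℝ) (X Y Z Ahat : ℕ → Ω → ℝ)
    (h : IsFeedbackTransmission μ n σ₀ P N f g A X Y Z Ahat) :
    awgnCapacity P N = ENNReal.ofReal (1 / 2 * Real.logb 2 (1 + (P : ℝ) / (N : ℝ))) ∧
    ((1 / 2 : ℝ) : EReal) *
        elogb2 ((σ₀ : ℝ≥0∞) ^ 2 / secondMoment μ (fun ω => A ω - Ahat (n - 1) ω))
      ≤ ((mutualInfoBits μ A (Ahat (n - 1)) : ℝ≥0∞) : EReal) ∧
    mutualInfoBits μ A (Ahat (n - 1)) ≤ (n : ℝ≥0∞) * awgnCapacity P N := by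
  obtain ⟨m, rfl⟩ : ∃ m, n = m + 1 := ⟨n - 1, by omega⟩
  rw [Nat.add_sub_cancel]
  have hA := h.measurable_source
  have hg := h.measurable_decoder m (by omega)
  have hpast := h.measurable_channelPast le_rfl
  have hAhat : Ahat m = fun ω => g m (channelPast A Y (m + 1) ω).2 :=
    funext fun ω => h.decode m (by omega) ω
  have hB : Measurable (Ahat m) := by
    rw [hAhat]
    exact hg.comp (measurable_snd.comp hpast)
  refine ⟨?_, ?_, ?_⟩
  · rw [awgnCapacity_eq_ofReal_div P hN.ne',
      ← ENNReal.ofReal_div_of_pos (Real.log_pos one_lt_two), Real.logb]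
    congr 1
    ring
  · rw [← ENNReal.coe_pow]
    exact half_mul_elogb2_le_mutualInfoBits hA hB (pow_ne_zero 2 hσ₀.ne') h.law_source
  · obtain ⟨Q, hQ, hle⟩ := h.exists_klDiv_channelPast_le hN.ne' le_rfl
    have := Measure.isProbabilityMeasure_map (μ := Q) hg.aemeasurable
    have := Measure.isProbabilityMeasure_map (μ := μ) hA.aemeasurable
    have := Measure.isProbabilityMeasure_map (μ := μ) hpast.aemeasurable
    rw [awgnCapacity_eq_ofReal_div P hN.ne', ← mul_div_assoc]
    -- Data processing: the last decoder is applied to the outputs under both the true law and the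
    -- reference law.
    refine mutualInfoBits_le_of_klDiv_le hA hB (Q.map (g m)) (le_trans ?_ hle)
    have h1 : μ.map (fun ω => (A ω, Ahat m ω)) =
        (μ.map (channelPast A Y (m + 1))).map (Prod.map id (g m)) := by
      rw [Measure.map_map (measurable_id.prodMap hg) hpast, hAhat]
      rfl
    have h2 : (μ.map A).prod (Q.map (g m)) = ((μ.map A).prod Q).map (Prod.map id (g m)) := by
      rw [← Measure.map_prod_map _ _ measurable_id hg, Measure.map_id]
    rw [h1, h2]
    exact InformationTheory.klDiv_map_le _ _ (measurable_id.prodMap hg)
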